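/- Let $n\ge 1$ and let $\mathfrak g=Q(n)$ be the complex queer Lie superalgebra of block matrices $\begin{pmatrix}A&B\\B&A\end{pmatrix}$, $A,B\in\mathrm{Mat}_n(\mathbb C)$ (even part $B=0$, odd part $A=0$), with the supercommutator as bracket. It has the basis $$e_{i,j}=\begin{pmatrix}E_{ij}&0\\0&E_{ij}\end{pmatrix},\qquad f_{i,j}=\begin{pmatrix}0&E_{ij}\\E_{ij}&0\end{pmatrix}\qquad(1\le i,j\le n).$$ Put $\mathrm{otr}\begin{pmatrix}A&B\\B&A\end{pmatrix}=\mathrm{tr}\,B$, let $E=\sum_{i=1}^{n-1}f_{i,i+1}$, and let $\chi\in\mathfrak g^*$ be the even regular nilpotent functional $\chi(x)=\mathrm{otr}(xE)$. Let $\mathfrak g=\bigoplus_d\mathfrak g_d$ be the Dynkin grading, $\mathfrak g_d=\{x:[h,x]=dx\}$, where $h=\sum_{i=1}^n(n+1-2i)e_{i,i}$, and let $\mathfrak m=\bigoplus_{j\ge1}\mathfrak g_{-2j}$. Let $I_\chi$ be the left ideal of $U(\mathfrak g)$ generated by all $a-\chi(a)$, $a\in\mathfrak m$, let $\pi:U(\mathfrak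 g)\to Q_\chi=U(\mathfrak g)/I_\chi$ be the projection, and let $W_\chi=\mathrm{End}_{U(\mathfrak g)}(Q_\chi)^{op}$ be the finite $W$-algebra. It is identified, via $w\mapsto w(\pi(1))$, with $$Q_\chi^{\mathfrak m}=\{u\in Q_\chi: au=\chi(a)u\ \text{for all } a\in\mathfrak m\},$$ with product $\pi(y_1)\pi(y_2)=\pi(y_1y_2)$. Define elements of $U(\mathfrak g)$ by $e_{i,j}^{(1)}=e_{i,j}$, $f_{i,j}^{(1)}=f_{i,j}$ and, for $m\ge 2$, $$e_{i,j}^{(m)}=\sum_{k=1}^n e_{i,k}e_{k,j}^{(m-1)}+(-1)^{m+1}\sum_{k=1}^n f_{i,k}f_{k,j}^{(m-1)},\qquad f_{i,j}^{(m)}=\sum_{k=1}^n e_{i,k}f_{k,j}^{(m-1)}+(-1)^{m+1}\sum_{k=1}^n f_{i,k}e_{k,j}^{(m-1)}.$$ Then for all odd integers $k,m$ with $n+k\ge1$ and $n+m\ge1$, the elements $\pi(e_{n,1}^{(n+k)})$ and $\pi(e_{n,1}^{(n+m)})$ lie in $W_\chi$ and commute there: $$[\pi(e_{n,1}^{(n+k)}),\pi(e_{n,1}^{(n+m)})]=0.$$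 -/

import Mathlib

noncomputable section

namespace QueerW

/-- The queer Lie superalgebra `Q(n)`: the complex block matrices `(A B; B A)`.  They form an
associative subalgebra of the `2n × 2n` matrices; the superbracket of homogeneous elements is the
supercommutator, which is used in `EnvRel` below. -/
def queer (n : ℕ) : Subalgebra ℂ (Matrix (Fin n ⊕ Fin n) (Fin n ⊕ Fin n) ℂ) where
  carrier := {X | ∃ A B : Matrix (Fin n) (Fin n) ℂ, X = Matrix.fromBlocks A B B A}
  mul_mem' := by
    rintro _ _ ⟨A, B, rfl⟩ ⟨C, D, rfl⟩
    exact ⟨A * C + B * D, A * D + B * C, by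
      rw [Matrix.fromBlocks_multiply, add_comm (B * C), add_comm (B * D)]⟩
  add_mem' := by
    rintro _ _ ⟨A, B, rfl⟩ ⟨C, D, rfl⟩
    exact ⟨A + C, B + D, by rw [Matrix.fromBlocks_add]⟩
  algebraMap_mem' := by
    intro r
    refine ⟨algebraMap ℂ _ r, 0, ?_⟩
    simp only [Matrix.algebraMap_eq_diagonal, Pi.algebraMap_def, Algebra.algebraMap_self,
      RingHom.id_apply, Matrix.fromBlocks_diagonal]
    congr 1
    ext x
    cases x <;> rfl

/-- The homogeneous part of `Q(n)` of a given parity: `(A 0; 0 A)` is even (parity `0`),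
`(0 B; B 0)` is odd (parity `1`). -/
def parityPart (n : ℕ) (p : ZMod 2) : Submodule ℂ (queer n) where
  carrier := {X | if p = 0 then X.1.toBlocks₁₂ = 0 else X.1.toBlocks₁₁ = 0}
  add_mem' := by
    intro X Y hX hY
    simp only [Set.mem_ofPred_eq] at hX hY ⊢
    split_ifs at hX hY ⊢
    · ext i j
      simpa [Matrix.toBlocks₁₂] using congrArg₂ (· + ·) (congrFun₂ hX i j) (congrFun₂ hY i j)
    · ext i j
      simpa [Matrix.toBlocks₁₁] using congrArg₂ (· + ·) (congrFun₂ hX i j) (congrFun₂ hY i j)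
  zero_mem' := by
    simp only [Set.mem_ofPred_eq]
    split_ifs <;> rfl
  smul_mem' := by
    intro c X hX
    simp only [Set.mem_ofPred_eq] at hX ⊢
    split_ifs at hX ⊢
    · ext i j
      simpa [Matrix.toBlocks₁₂] using congrArg (c * ·) (congrFun₂ hX i j)
    · ext i j
      simpa [Matrix.toBlocks₁₁] using congrArg (c * ·) (congrFun₂ hX i j)

/-- The sign `(-1)^{pq}` of two parities. -/
def sgn (p q : ZMod 2) : ℂ := (-1) ^ (p.val * q.val)

/-- The defining relations `x y - (-1)^{p(x)p(y)} y x = [x, y]` (for homogeneous `x`, `y`) of the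
universal enveloping algebra, where `[x, y]` is the supercommutator of the matrices `x`, `y`. -/
inductive EnvRel (n : ℕ) : TensorAlgebra ℂ (queer n) → TensorAlgebra ℂ (queer n) → Prop
  | bracket (p q : ZMod 2) (X Y : queer n) (hX : X ∈ parityPart n p) (hY : Y ∈ parityPart n q) :
      EnvRel n
        (TensorAlgebra.ι ℂ X * TensorAlgebra.ι ℂ Y
          - sgn p q • (TensorAlgebra.ι ℂ Y * TensorAlgebra.ι ℂ X))
        (TensorAlgebra.ι ℂ (X * Y - sgn p q • (Y * X)))

/-- The universal enveloping algebra `U(Q(n))`. -/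
def U (n : ℕ) : Type := RingQuot (EnvRel n)

instance (n : ℕ) : Ring (U n) := inferInstanceAs (Ring (RingQuot (EnvRel n)))

instance (n : ℕ) : Algebra ℂ (U n) := inferInstanceAs (Algebra ℂ (RingQuot (EnvRel n)))

/-- The quotient map from the tensor algebra. -/
def mkU (n : ℕ) : TensorAlgebra ℂ (queer n) →ₐ[ℂ] U n := RingQuot.mkAlgHom ℂ (EnvRel n)

/-- The canonical map `Q(n) → U(Q(n))`. -/
def ι (n : ℕ) : queer n →ₗ[ℂ] U n :=
  (mkU n).toLinearMap ∘ₗ TensorAlgebra.ι ℂ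

/-- The relations of `U(Q(n))`, in `U(Q(n))`. -/
theorem ι_bracket (n : ℕ) (p q : ZMod 2) (X Y : queer n) (hX : X ∈ parityPart n p)
    (hY : Y ∈ parityPart n q) :
    ι n X * ι n Y - sgn p q • (ι n Y * ι n X) = ι n (X * Y - sgn p q • (Y * X)) := by
  have key : mkU n _ = mkU n _ := RingQuot.mkAlgHom_rel ℂ (EnvRel.bracket p q X Y hX hY)
  rw [map_sub, map_smul, map_mul, map_mul] at key
  exact key

/-- The even basis element `e_{i,j}`. -/
def e (n : ℕ) (i j : Fin n) : queer n :=
  ⟨Matrix.fromBlocks (Matrix.single i j 1) 0 0 (Matrix.single i j 1), _, _, rfl⟩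

/-- The odd basis element `f_{i,j}`. -/
def f (n : ℕ) (i j : Fin n) : queer n :=
  ⟨Matrix.fromBlocks 0 (Matrix.single i j 1) (Matrix.single i j 1) 0, _, _, rfl⟩

/-- The odd trace `(A B; B A) ↦ tr B`. -/
def otr (n : ℕ) : queer n →ₗ[ℂ] ℂ where
  toFun X := X.1.toBlocks₁₂.trace
  map_add' X Y := by
    simp [Matrix.trace, Matrix.toBlocks₁₂, Finset.sum_add_distrib]
  map_smul' c X := by
    simp [Matrix.trace, Matrix.toBlocks₁₂, Finset.mul_sum]

/-- `E = ∑ f_{i,i+1}`. -/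
def E (n : ℕ) : queer n := ∑ i : Fin n, ∑ j : Fin n, if j.val = i.val + 1 then f n i j else 0

/-- The regular nilpotent functional `χ(x) = (x|E) = otr(xE)`. -/
def χ (n : ℕ) : queer n →ₗ[ℂ] ℂ := otr n ∘ₗ LinearMap.mulRight ℂ (E n)

/-- `h = diag(n-1, n-3, …, 1-n)`, as an even element of `Q(n)`. -/
def h (n : ℕ) : queer n := ∑ i : Fin n, ((n : ℂ) - 1 - 2 * (i.val : ℂ)) • e n i i

/-- The piece `𝔤_d = {x : [h, x] = d x}` of the Dynkin grading (`h` is even, so the bracket with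
`h` is the ordinary commutator). -/
def dynkinPart (n : ℕ) (d : ℤ) : Submodule ℂ (queer n) :=
  LinearMap.ker (LinearMap.mulLeft ℂ (h n) - LinearMap.mulRight ℂ (h n)
    - (d : ℂ) • LinearMap.id)

/-- `𝔪 = ⨁_{j ≥ 1} 𝔤_{-2j}`. -/
def 𝔪 (n : ℕ) : Submodule ℂ (queer n) := ⨆ j : ℕ, dynkinPart n (-2 * ((j : ℤ) + 1))

/-- The left ideal `I_χ` of `U(Q(n))` generated by `a - χ(a)`, `a ∈ 𝔪`. -/
def I (n : ℕ) : Submodule (U n) (U n) :=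
  Submodule.span (U n) {u | ∃ a ∈ 𝔪 n, u = ι n a - algebraMap ℂ (U n) (χ n a)}

/-- The generalized Whittaker module `Q_χ = U(Q(n)) / I_χ`. -/
abbrev Q (n : ℕ) : Type := U n ⧸ I n

/-- The projection `π : U(Q(n)) → U(Q(n)) / I_χ`. -/
def π (n : ℕ) : U n →ₗ[U n] Q n := (I n).mkQ

/-- The finite `W`-algebra `W_χ = End_{U(Q(n))}(Q_χ)^{op}`. -/
abbrev W (n : ℕ) : Type := (Module.End (U n) (Q n))ᵐᵒᵖ

/-- The space `Q_χ^𝔪 = {u ∈ Q_χ : a u = χ(a) u for all a ∈ 𝔪}`. -/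
def whittaker (n : ℕ) : Submodule ℂ (Q n) where
  carrier := {u | ∀ a ∈ 𝔪 n, ι n a • u = χ n a • u}
  add_mem' hu hv a ha := by rw [smul_add, smul_add, hu a ha, hv a ha]
  zero_mem' a _ := by rw [smul_zero, smul_zero]
  smul_mem' c u hu a ha := by rw [smul_comm, hu a ha, smul_comm]

theorem smul_π_one (n : ℕ) (x : U n) : x • π n 1 = π n x := by
  rw [← map_smul, smul_eq_mul, mul_one]

theorem π_one_mem (n : ℕ) : π n 1 ∈ whittaker n := by
  intro a ha
  have h1 : π n (ι n a - algebraMap ℂ (U n) (χ n a)) = 0 :=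
    (Submodule.Quotient.mk_eq_zero _).2 (Submodule.subset_span ⟨a, ha, rfl⟩)
  rw [map_sub, sub_eq_zero] at h1
  rw [smul_π_one, h1, ← smul_π_one, algebraMap_smul]

theorem I_le (n : ℕ) (u : whittaker n) : I n ≤ LinearMap.ker (LinearMap.toSpanSingleton (U n) (Q n) u) := by
  refine Submodule.span_le.2 ?_
  rintro _ ⟨a, ha, rfl⟩
  rw [SetLike.mem_coe, LinearMap.mem_ker, LinearMap.toSpanSingleton_apply, sub_smul, sub_eq_zero,
    algebraMap_smul]
  exact u.2 a ha

/-- The identification of `W_χ` with `Q_χ^𝔪`: an endomorphism `w` corresponds to `w(π(1))`. -/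
def identify (n : ℕ) : W n ≃ₗ[ℂ] whittaker n where
  toFun w := ⟨w.unop (π n 1), fun a ha => by
    rw [← map_smul, π_one_mem n a ha, LinearMap.map_smul_of_tower]⟩
  map_add' w w' := rfl
  map_smul' c w := rfl
  invFun u := MulOpposite.op ((I n).liftQ (LinearMap.toSpanSingleton (U n) (Q n) u) (I_le n u))
  left_inv w := by
    apply MulOpposite.unop_injective
    apply Submodule.linearMap_qext
    ext
    exact one_smul (U n) (w.unop (π n 1))
  right_inv u := by
    apply Subtype.ext
    exact one_smul (U n) (u : Q n)

/-- The product of `W_χ` is `π(y₁)π(y₂) = π(y₁y₂)` under this identification. -/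
theorem identify_mul (n : ℕ) (y₁ y₂ : U n) (w₁ w₂ : W n)
    (h₁ : (identify n w₁ : Q n) = π n y₁) (h₂ : (identify n w₂ : Q n) = π n y₂) :
    (identify n (w₁ * w₂) : Q n) = π n (y₁ * y₂) := by
  change w₁.unop (π n 1) = π n y₁ at h₁
  change w₂.unop (π n 1) = π n y₂ at h₂
  change w₂.unop (w₁.unop (π n 1)) = π n (y₁ * y₂)
  rw [h₁, ← smul_π_one n y₁, map_smul, h₂, ← map_smul, smul_eq_mul]

/-- The pair of families `(e_{i,j}^{(m)}, f_{i,j}^{(m)})` of Sergeev's elements of `U(Q(n))`: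
`e^{(m)}_{ij} = ∑ₖ e_{ik} e^{(m-1)}_{kj} + (-1)^{m+1} ∑ₖ f_{ik} f^{(m-1)}_{kj}` and
`f^{(m)}_{ij} = ∑ₖ e_{ik} f^{(m-1)}_{kj} + (-1)^{m+1} ∑ₖ f_{ik} e^{(m-1)}_{kj}`.
The recursion starts at `e^{(0)}_{ij} = δ_{ij}`, `f^{(0)}_{ij} = 0`, which amounts to
`e^{(1)}_{ij} = e_{ij}`, `f^{(1)}_{ij} = f_{ij}`, see `eS_one` and `fS_one`. -/
def sergeev (n : ℕ) : ℕ → (Fin n → Fin n → U n) × (Fin n → Fin n → U n)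
  | 0 => (fun i j => if i = j then 1 else 0, fun _ _ => 0)
  | m + 1 =>
    (fun i j => ∑ k, ι n (e n i k) * (sergeev n m).1 k j
        + (-1) ^ (m + 2) * ∑ k, ι n (f n i k) * (sergeev n m).2 k j,
     fun i j => ∑ k, ι n (e n i k) * (sergeev n m).2 k j
        + (-1) ^ (m + 2) * ∑ k, ι n (f n i k) * (sergeev n m).1 k j)

/-- `e_{i,j}^{(m)}`. -/
def eS (n m : ℕ) (i j : Fin n) : U n := (sergeev n m).1 i j

/-- `f_{i,j}^{(m)}`. -/
def fS (n m : ℕ) (i j : Fin n) : U n := (sergeev n m).2 i j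

theorem eS_one (n : ℕ) (i j : Fin n) : eS n 1 i j = ι n (e n i j) := by
  simp [eS, sergeev]

theorem fS_one (n : ℕ) (i j : Fin n) : fS n 1 i j = ι n (f n i j) := by
  simp [fS, sergeev]

end QueerW

end

namespace QueerW

/-! The commutation already holds in U(Q(n)), before passing to Q_χ: for fixed i, j, the elements
e^{(r)}_{ij} and e^{(s)}_{ij} commute whenever r + s is even (`eS_comm`), and (n+k) + (n+m) is even
for odd k, m.

Induction along Sergeev's recursion gives the brackets with the generators (`generator_sergeev`),
and then expresses the superbracket of any two Sergeev elements as a sum of quadratic terms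
(`comm_eS`, `comm_fS`). When both elements have the same indices i, j, these relations involve only
x_r = e^{(r)}_{ij} and y_r = f^{(r)}_{ij}. `commute_of_quadratic` shows, in any ring, that such
relations force [x_r, x_s] = 0 for r + s even: [x_{r+2}, x_s] - [x_r, x_{s+2}] reduces to
commutators of smaller even total index.

The corner position (n,1) matters only for membership in W_χ: 𝔪 is strictly lower triangular, so it
commutes with e^{(m)}_{n,1} (`ι_mul_eS_corner`). -/

/-! ### Products of basis elements and their superbrackets in U(Q(n)). -/

theorem e_mem_parityPart (n : ℕ) (i j : Fin n) : e n i j ∈ parityPart n 0 := rfl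

theorem f_mem_parityPart (n : ℕ) (i j : Fin n) : f n i j ∈ parityPart n 1 := rfl

theorem e_mul_e (n : ℕ) (i j k l : Fin n) :
    e n i j * e n k l = if j = k then e n i l else 0 := by
  apply Subtype.ext
  split_ifs with hjk
  · subst hjk
    simp [e, Matrix.fromBlocks_multiply]
  · simp [e, Matrix.fromBlocks_multiply, hjk]

theorem e_mul_f (n : ℕ) (i j k l : Fin n) :
    e n i j * f n k l = if j = k then f n i l else 0 := by
  apply Subtype.ext
  split_ifs with hjk
  · subst hjk
    simp [e, f, Matrix.fromBlocks_multiply]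
  · simp [e, f, Matrix.fromBlocks_multiply, hjk]

theorem f_mul_e (n : ℕ) (i j k l : Fin n) :
    f n i j * e n k l = if j = k then f n i l else 0 := by
  apply Subtype.ext
  split_ifs with hjk
  · subst hjk
    simp [e, f, Matrix.fromBlocks_multiply]
  · simp [e, f, Matrix.fromBlocks_multiply, hjk]

theorem f_mul_f (n : ℕ) (i j k l : Fin n) :
    f n i j * f n k l = if j = k then e n i l else 0 := by
  apply Subtype.ext
  split_ifs with hjk
  · subst hjk
    simp [e, f, Matrix.fromBlocks_multiply]
  · simp [f, Matrix.fromBlocks_multiply, hjk]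

theorem sgn_zero_left (p : ZMod 2) : sgn 0 p = 1 := by simp [sgn]

theorem sgn_zero_right (p : ZMod 2) : sgn p 0 = 1 := by simp [sgn]

theorem sgn_one_one : sgn 1 1 = -1 := by simp [sgn, ZMod.val_one]

theorem ι_e_ι_e (n : ℕ) (i j k l : Fin n) :
    ι n (e n i j) * ι n (e n k l) - ι n (e n k l) * ι n (e n i j)
      = (if j = k then ι n (e n i l) else 0) - if i = l then ι n (e n k j) else 0 := by
  have key := ι_bracket n 0 0 _ _ (e_mem_parityPart n i j) (e_mem_parityPart n k l)
  rw [sgn_zero_left, one_smul, one_smul, e_mul_e, e_mul_e, map_sub, apply_ite (ι n),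
    apply_ite (ι n), map_zero] at key
  simpa only [eq_comm (a := l)] using key

theorem ι_e_ι_f (n : ℕ) (i j k l : Fin n) :
    ι n (e n i j) * ι n (f n k l) - ι n (f n k l) * ι n (e n i j)
      = (if j = k then ι n (f n i l) else 0) - if i = l then ι n (f n k j) else 0 := by
  have key := ι_bracket n 0 1 _ _ (e_mem_parityPart n i j) (f_mem_parityPart n k l)
  rw [sgn_zero_left, one_smul, one_smul, e_mul_f, f_mul_e, map_sub, apply_ite (ι n),
    apply_ite (ι n), map_zero] at key
  simpa only [eq_comm (a := l)] using key

theorem ι_f_ι_e (n : ℕ) (i j k l : Fin n) :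
    ι n (f n i j) * ι n (e n k l) - ι n (e n k l) * ι n (f n i j)
      = (if j = k then ι n (f n i l) else 0) - if i = l then ι n (f n k j) else 0 := by
  have key := ι_bracket n 1 0 _ _ (f_mem_parityPart n i j) (e_mem_parityPart n k l)
  rw [sgn_zero_right, one_smul, one_smul, e_mul_f, f_mul_e, map_sub, apply_ite (ι n),
    apply_ite (ι n), map_zero] at key
  simpa only [eq_comm (a := l)] using key

theorem ι_f_ι_f (n : ℕ) (i j k l : Fin n) :
    ι n (f n i j) * ι n (f n k l) + ι n (f n k l) * ι n (f n i j)
      = (if j = k then ι n (e n i l) else 0) + if i = l then ι n (e n k j) else 0 := by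
  have key := ι_bracket n 1 1 _ _ (f_mem_parityPart n i j) (f_mem_parityPart n k l)
  rw [sgn_one_one, neg_one_smul, neg_one_smul, sub_neg_eq_add, sub_neg_eq_add, f_mul_f, f_mul_f,
    map_add, apply_ite (ι n), apply_ite (ι n), map_zero] at key
  simpa only [eq_comm (a := l)] using key

/-! ### Sergeev's recursion and superbrackets with the generators. -/

theorem eS_zero (n : ℕ) (i j : Fin n) : eS n 0 i j = if i = j then 1 else 0 := rfl

theorem fS_zero (n : ℕ) (i j : Fin n) : fS n 0 i j = 0 := rfl

theorem eS_succ (n m : ℕ) (i j : Fin n) :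
    eS n (m + 1) i j = ∑ k, ι n (e n i k) * eS n m k j
      + (-1) ^ m * ∑ k, ι n (f n i k) * fS n m k j := by
  have hsgn : (-1 : U n) ^ m = (-1) ^ (m + 2) := by rw [pow_add, neg_one_sq, mul_one]
  rw [hsgn]
  rfl

theorem fS_succ (n m : ℕ) (i j : Fin n) :
    fS n (m + 1) i j = ∑ k, ι n (e n i k) * fS n m k j
      + (-1) ^ m * ∑ k, ι n (f n i k) * eS n m k j := by
  have hsgn : (-1 : U n) ^ m = (-1) ^ (m + 2) := by rw [pow_add, neg_one_sq, mul_one]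
  rw [hsgn]
  rfl

section Leibniz

variable {R : Type*} [Ring R] (a b c : R)

/-- These four identities are the super Leibniz rule, one for each parity pattern needed below; the
primed ones are for a and b both odd. -/
theorem comm_mul : a * (b * c) - b * c * a = (a * b - b * a) * c + b * (a * c - c * a) := by
  noncomm_ring

theorem comm_mul' : a * (b * c) - b * c * a = (a * b + b * a) * c - b * (a * c + c * a) := by
  noncomm_ring

theorem anticomm_mul : a * (b * c) + b * c * a = (a * b - b * a) * c + b * (a * c + c * a) := by
  noncomm_ring

theorem anticomm_mul' : a * (b * c) + b * c * a = (a * b + b * a) * c - b * (a * c - c * a) := by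
  noncomm_ring

end Leibniz

set_option linter.unusedSimpArgs false in
/-- The supercommutators of the generators of `Q(n)` with Sergeev's elements. -/
theorem generator_sergeev (n s : ℕ) :
    (∀ i j k l : Fin n, ι n (e n i j) * eS n s k l - eS n s k l * ι n (e n i j)
      = (if j = k then eS n s i l else 0) - if i = l then eS n s k j else 0) ∧
    (∀ i j k l : Fin n, ι n (e n i j) * fS n s k l - fS n s k l * ι n (e n i j)
      = (if j = k then fS n s i l else 0) - if i = l then fS n s k j else 0) ∧
    (∀ i j k l : Fin n, ι n (f n i j) * eS n s k l - eS n s k l * ι n (f n i j)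
      = (if j = k then (-1) ^ (s + 1) * fS n s i l else 0) - if i = l then fS n s k j else 0) ∧
    (∀ i j k l : Fin n, ι n (f n i j) * fS n s k l + fS n s k l * ι n (f n i j)
      = (if j = k then (-1) ^ (s + 1) * eS n s i l else 0) + if i = l then eS n s k j else 0) := by
  induction s with
  | zero =>
    simp only [eS_zero, fS_zero]
    refine ⟨fun i j k l => ?_, fun i j k l => ?_, fun i j k l => ?_, fun i j k l => ?_⟩ <;>
      by_cases hjk : j = k <;> by_cases hil : i = l <;> by_cases hkl : k = l <;>
      simp_all [eq_comm]
  | succ s ih =>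
    obtain ⟨ih1, ih2, ih3, ih4⟩ := ih
    have hs := Nat.even_or_odd s
    -- After the Leibniz rule, the terms where the generator meets the summation index p cancel:
    -- within each sum for an even generator, between the e-sum and the f-sum for an odd one.
    refine ⟨fun i j k l => ?_, fun i j k l => ?_, fun i j k l => ?_, fun i j k l => ?_⟩
    · have h1 : ∑ p, (ι n (e n i j) * (ι n (e n k p) * eS n s p l)
          - (ι n (e n k p) * eS n s p l) * ι n (e n i j)) = _ :=
        Finset.sum_congr rfl fun p _ => by rw [comm_mul, ih1, ι_e_ι_e]
      have h2 : ∑ p, (ι n (e n i j) * (ι n (f n k p) * fS n s p l)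
          - (ι n (f n k p) * fS n s p l) * ι n (e n i j)) = _ :=
        Finset.sum_congr rfl fun p _ => by rw [comm_mul, ih2, ι_e_ι_f]
      rw [Finset.sum_sub_distrib, ← Finset.mul_sum, ← Finset.sum_mul, sub_eq_iff_eq_add] at h1 h2
      simp only [eS_succ, fS_succ]
      rcases hs with hs | hs <;> by_cases hjk : j = k <;> by_cases hil : i = l <;>
        simp only [hs.neg_one_pow, mul_add, add_mul, one_mul, neg_mul, mul_neg, h1, h2] <;>
        simp [hjk, hil, pow_succ, hs.neg_one_pow, sub_mul, mul_sub, add_mul, mul_add,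
          Finset.sum_add_distrib] <;>
        abel
    · have h1 : ∑ p, (ι n (e n i j) * (ι n (e n k p) * fS n s p l)
          - (ι n (e n k p) * fS n s p l) * ι n (e n i j)) = _ :=
        Finset.sum_congr rfl fun p _ => by rw [comm_mul, ih2, ι_e_ι_e]
      have h2 : ∑ p, (ι n (e n i j) * (ι n (f n k p) * eS n s p l)
          - (ι n (f n k p) * eS n s p l) * ι n (e n i j)) = _ :=
        Finset.sum_congr rfl fun p _ => by rw [comm_mul, ih1, ι_e_ι_f]
      rw [Finset.sum_sub_distrib, ← Finset.mul_sum, ← Finset.sum_mul, sub_eq_iff_eq_add] at h1 h2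
      simp only [eS_succ, fS_succ]
      rcases hs with hs | hs <;> by_cases hjk : j = k <;> by_cases hil : i = l <;>
        simp only [hs.neg_one_pow, mul_add, add_mul, one_mul, neg_mul, mul_neg, h1, h2] <;>
        simp [hjk, hil, pow_succ, hs.neg_one_pow, sub_mul, mul_sub, add_mul, mul_add,
          Finset.sum_add_distrib] <;>
        abel
    · have h1 : ∑ p, (ι n (f n i j) * (ι n (e n k p) * eS n s p l)
          - (ι n (e n k p) * eS n s p l) * ι n (f n i j)) = _ :=
        Finset.sum_congr rfl fun p _ => by rw [comm_mul, ih3, ι_f_ι_e]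
      have h2 : ∑ p, (ι n (f n i j) * (ι n (f n k p) * fS n s p l)
          - (ι n (f n k p) * fS n s p l) * ι n (f n i j)) = _ :=
        Finset.sum_congr rfl fun p _ => by rw [comm_mul', ih4, ι_f_ι_f]
      rw [Finset.sum_sub_distrib, ← Finset.mul_sum, ← Finset.sum_mul, sub_eq_iff_eq_add] at h1 h2
      simp only [eS_succ, fS_succ]
      rcases hs with hs | hs <;> by_cases hjk : j = k <;> by_cases hil : i = l <;>
        simp only [hs.neg_one_pow, mul_add, add_mul, one_mul, neg_mul, mul_neg, h1, h2] <;>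
        simp [hjk, hil, pow_succ, hs.neg_one_pow, sub_mul, mul_sub, add_mul, mul_add,
          Finset.sum_add_distrib] <;>
        abel
    · have h1 : ∑ p, (ι n (f n i j) * (ι n (e n k p) * fS n s p l)
          + (ι n (e n k p) * fS n s p l) * ι n (f n i j)) = _ :=
        Finset.sum_congr rfl fun p _ => by rw [anticomm_mul, ih4, ι_f_ι_e]
      have h2 : ∑ p, (ι n (f n i j) * (ι n (f n k p) * eS n s p l)
          + (ι n (f n k p) * eS n s p l) * ι n (f n i j)) = _ :=
        Finset.sum_congr rfl fun p _ => by rw [anticomm_mul', ih3, ι_f_ι_f]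
      rw [Finset.sum_add_distrib, ← Finset.mul_sum, ← Finset.sum_mul, ← eq_sub_iff_add_eq] at h1 h2
      simp only [eS_succ, fS_succ]
      rcases hs with hs | hs <;> by_cases hjk : j = k <;> by_cases hil : i = l <;>
        simp only [hs.neg_one_pow, mul_add, add_mul, one_mul, neg_mul, mul_neg, h1, h2] <;>
        simp [hjk, hil, pow_succ, hs.neg_one_pow, sub_mul, mul_sub, add_mul, mul_add,
          Finset.sum_add_distrib] <;>
        abel

/-! ### The recursion as an additive operator, and its action on quadratic expressions. -/

/-- The operator `(u, v) ↦ (∑ₐ e_{i,a} uₐ) + (-1)ᵗ (∑ₐ f_{i,a} vₐ)` in Sergeev's recursion. -/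
def step (n t : ℕ) (i : Fin n) : (Fin n → U n) × (Fin n → U n) →+ U n where
  toFun u := ∑ a, ι n (e n i a) * u.1 a + (-1 : ℤ) ^ t • ∑ a, ι n (f n i a) * u.2 a
  map_zero' := by simp
  map_add' u v := by
    simp only [Prod.fst_add, Prod.snd_add, Pi.add_apply, mul_add, Finset.sum_add_distrib, smul_add]
    abel

theorem step_apply (n t : ℕ) (i : Fin n) (u v : Fin n → U n) :
    step n t i (u, v)
      = ∑ a, ι n (e n i a) * u a + (-1 : ℤ) ^ t • ∑ a, ι n (f n i a) * v a := rfl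

/-- Signs written as integer scalars can be normalised by `module`. -/
theorem neg_one_pow_zsmul {R : Type*} [Ring R] (t : ℕ) (x : R) :
    (-1 : ℤ) ^ t • x = (-1) ^ t * x := by
  rw [zsmul_eq_mul]
  push_cast
  rfl

theorem eS_succ_eq_step (n m : ℕ) (i j : Fin n) :
    eS n (m + 1) i j = step n m i (fun a => eS n m a j, fun a => fS n m a j) := by
  rw [eS_succ, step_apply, neg_one_pow_zsmul]

theorem fS_succ_eq_step (n m : ℕ) (i j : Fin n) :
    fS n (m + 1) i j = step n m i (fun a => fS n m a j, fun a => eS n m a j) := by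
  rw [fS_succ, step_apply, neg_one_pow_zsmul]

theorem step_mul_right (n t : ℕ) (i : Fin n) (u v : Fin n → U n) (c : U n) :
    step n t i (fun a => u a * c, fun a => v a * c) = step n t i (u, v) * c := by
  simp only [step_apply, add_mul, Finset.sum_mul, mul_assoc, smul_mul_assoc]

theorem step_sum {κ : Type*} (n t : ℕ) (i : Fin n) (S : Finset κ) (u v : κ → Fin n → U n) :
    step n t i (fun a => ∑ b ∈ S, u b a, fun a => ∑ b ∈ S, v b a)
      = ∑ b ∈ S, step n t i (u b, v b) := by
  rw [← map_sum]
  congr 1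
  ext a <;> simp [Prod.fst_sum, Prod.snd_sum]

theorem step_sub (n t : ℕ) (i : Fin n) (u v u' v' : Fin n → U n) :
    step n t i (fun a => u a - u' a, fun a => v a - v' a)
      = step n t i (u, v) - step n t i (u', v') :=
  map_sub (step n t i) (u, v) (u', v')

theorem step_smul (n t : ℕ) (i : Fin n) (c : ℤ) (u v : Fin n → U n) :
    step n t i (fun a => c • u a, fun a => c • v a) = c • step n t i (u, v) :=
  map_zsmul (step n t i) c (u, v)

/-- A quadratic expression in Sergeev's elements. -/
def quadE (n c p q : ℕ) (i j k l : Fin n) : U n :=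
  eS n p i l * eS n q k j - (-1 : ℤ) ^ c • (fS n p i l * fS n q k j)

/-- The companion of `quadE` of opposite parity. -/
def quadF (n c p q : ℕ) (i j k l : Fin n) : U n :=
  eS n p i l * fS n q k j - (-1 : ℤ) ^ c • (fS n p i l * eS n q k j)

/-- The operator acts on the left factors only. The parity condition is what makes the coefficients
of f·e^{(p)}·f^{(q)} and f·f^{(p)}·e^{(q)} agree with the recursion for index p + 1, whose own sign
is (-1)^p. -/
theorem step_quadE (n c t p q : ℕ) (i j k l : Fin n) (hc : Odd (c + t + p)) :
    step n t i (fun a => quadE n c p q a j k l, fun a => quadF n c p q a j k l)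
      = quadE n c (p + 1) q i j k l := by
  simp only [quadE, quadF, eS_succ_eq_step, fS_succ_eq_step, ← step_mul_right]
  simp only [step_apply, mul_sub, Finset.sum_sub_distrib, mul_smul_comm, ← Finset.smul_sum,
    smul_sub, smul_add, smul_smul]
  rcases Nat.even_or_odd c with h1 | h1 <;> rcases Nat.even_or_odd t with h2 | h2 <;>
    rcases Nat.even_or_odd p with h3 | h3 <;>
    first
    | (exfalso; grind)
    | (simp only [h1.neg_one_pow, h2.neg_one_pow, h3.neg_one_pow]; module)

theorem step_quadF (n c t p q : ℕ) (i j k l : Fin n) (hc : Odd (c + t + p)) :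
    step n t i (fun a => quadF n c p q a j k l, fun a => quadE n c p q a j k l)
      = quadF n c (p + 1) q i j k l := by
  simp only [quadE, quadF, eS_succ_eq_step, fS_succ_eq_step, ← step_mul_right]
  simp only [step_apply, mul_sub, Finset.sum_sub_distrib, mul_smul_comm, ← Finset.smul_sum,
    smul_sub, smul_add, smul_smul]
  rcases Nat.even_or_odd c with h1 | h1 <;> rcases Nat.even_or_odd t with h2 | h2 <;>
    rcases Nat.even_or_odd p with h3 | h3 <;>
    first
    | (exfalso; grind)
    | (simp only [h1.neg_one_pow, h2.neg_one_pow, h3.neg_one_pow]; module)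

/-- Negating the second component amounts to replacing t by t + 1. Pairs with such a sign arise from
brackets with an odd element, in `comm_fS`. -/
theorem step_smul_quadF_neg (n c t p q : ℕ) (z : ℤ) (i j k l : Fin n) (hc : Odd (c + (t + 1) + p)) :
    step n t i (fun a => z • quadF n c p q a j k l, fun a => z • -quadE n c p q a j k l)
      = z • quadF n c (p + 1) q i j k l := by
  rw [← step_quadF n c (t + 1) p q i j k l hc, step_smul]
  simp only [step_apply, mul_neg, Finset.sum_neg_distrib, pow_succ]
  module

theorem step_smul_quadE_neg (n c t p q : ℕ) (z : ℤ) (i j k l : Fin n) (hc : Odd (c + (t + 1) + p)) :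
    step n t i (fun a => z • -quadE n c p q a j k l, fun a => z • quadF n c p q a j k l)
      = z • -quadE n c (p + 1) q i j k l := by
  rw [← step_quadE n c (t + 1) p q i j k l hc, step_smul]
  simp only [step_apply, mul_neg, Finset.sum_neg_distrib, pow_succ]
  module

/-- Sergeev's elements multiply like powers. -/
theorem sum_quad (n s r : ℕ) (j : Fin n) : ∀ i,
    ∑ b, quadE n (r + 1) s r i j b b = eS n (s + r) i j ∧
    ∑ b, quadF n (r + 1) s r i j b b = fS n (s + r) i j := by
  induction s with
  | zero => intro i; simp [quadE, quadF, eS_zero, fS_zero]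
  | succ s ih =>
    intro i
    have hodd : Odd (r + 1 + (s + r) + s) := ⟨r + s, by ring⟩
    rw [show s + 1 + r = s + r + 1 by ring, eS_succ_eq_step, fS_succ_eq_step]
    simp only [← fun i => (ih i).1, ← fun i => (ih i).2, step_sum, step_quadE _ _ _ _ _ _ _ _ _ hodd,
      step_quadF _ _ _ _ _ _ _ _ _ hodd, and_self]

/-! ### Superbrackets of two Sergeev elements. -/

theorem step_comm (n t : ℕ) (i : Fin n) (u v : Fin n → U n) (c : U n) :
    step n t i (u, v) * c - c * step n t i (u, v)
      = step n t i (fun a => u a * c - c * u a, fun a => v a * c - c * v a)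
        + (∑ a, (ι n (e n i a) * c - c * ι n (e n i a)) * u a
          + (-1 : ℤ) ^ t • ∑ a, (ι n (f n i a) * c - c * ι n (f n i a)) * v a) := by
  simp only [step_apply, mul_add, mul_sub, add_mul, sub_mul, Finset.sum_sub_distrib,
    Finset.mul_sum, Finset.sum_mul, mul_assoc, smul_mul_assoc, mul_smul_comm, smul_sub]
  module

/-- Here c plays the role of an odd element: carrying it past an f changes the sign, so v
contributes an anticommutator. -/
theorem step_comm_of_odd (n t : ℕ) (i : Fin n) (u v : Fin n → U n) (c : U n) :
    step n t i (u, v) * c - c * step n t i (u, v)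
      = step n t i (fun a => u a * c - c * u a, fun a => v a * c + c * v a)
        + (∑ a, (ι n (e n i a) * c - c * ι n (e n i a)) * u a
          - (-1 : ℤ) ^ t • ∑ a, (ι n (f n i a) * c + c * ι n (f n i a)) * v a) := by
  simp only [step_apply, mul_add, mul_sub, add_mul, sub_mul, Finset.sum_sub_distrib,
    Finset.sum_add_distrib, smul_add,
    Finset.mul_sum, Finset.sum_mul, mul_assoc, smul_mul_assoc, mul_smul_comm]
  module

theorem step_anticomm (n t : ℕ) (i : Fin n) (u v : Fin n → U n) (c : U n) :
    step n t i (v, u) * c + c * step n t i (v, u)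
      = step n t i (fun a => v a * c + c * v a, fun a => u a * c - c * u a)
        + ((-1 : ℤ) ^ t • ∑ a, (ι n (f n i a) * c + c * ι n (f n i a)) * u a
          - ∑ a, (ι n (e n i a) * c - c * ι n (e n i a)) * v a) := by
  simp only [step_apply, mul_add, mul_sub, add_mul, sub_mul, Finset.sum_sub_distrib,
    Finset.sum_add_distrib, smul_add, smul_sub,
    Finset.mul_sum, Finset.sum_mul, mul_assoc, smul_mul_assoc, mul_smul_comm]
  module

theorem sum_delta_sub_mul {R : Type*} [Ring R] {n : ℕ} (k : Fin n) (p : Prop) [Decidable p] (c : R)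
    (z w : Fin n → R) :
    ∑ a, ((if a = k then c else 0) - if p then z a else 0) * w a
      = c * w k - if p then ∑ a, z a * w a else 0 := by
  by_cases hp : p <;> simp [hp, sub_mul]

theorem sum_delta_add_mul {R : Type*} [Ring R] {n : ℕ} (k : Fin n) (p : Prop) [Decidable p] (c : R)
    (z w : Fin n → R) :
    ∑ a, ((if a = k then c else 0) + if p then z a else 0) * w a
      = c * w k + if p then ∑ a, z a * w a else 0 := by
  by_cases hp : p <;> simp [hp, add_mul, Finset.sum_add_distrib]

theorem quadE_zero (n c q : ℕ) (i j k l : Fin n) :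
    quadE n c 0 q i j k l = if i = l then eS n q k j else 0 := by
  simp [quadE, eS_zero, fS_zero]

theorem quadF_zero (n c q : ℕ) (i j k l : Fin n) :
    quadF n c 0 q i j k l = if i = l then fS n q k j else 0 := by
  simp [quadF, eS_zero, fS_zero]

theorem eS_add (n s r : ℕ) (i j : Fin n) :
    eS n (s + r) i j
      = ∑ b, eS n s i b * eS n r b j + (-1 : ℤ) ^ r • ∑ b, fS n s i b * fS n r b j := by
  rw [← (sum_quad n s r j i).1]
  simp only [quadE, Finset.sum_sub_distrib, ← Finset.smul_sum, pow_succ]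
  module

theorem fS_add (n s r : ℕ) (i j : Fin n) :
    fS n (s + r) i j
      = ∑ b, eS n s i b * fS n r b j + (-1 : ℤ) ^ r • ∑ b, fS n s i b * eS n r b j := by
  rw [← (sum_quad n s r j i).2]
  simp only [quadF, Finset.sum_sub_distrib, ← Finset.smul_sum, pow_succ]
  module

/-- Commutators of Sergeev's elements with the even ones. -/
theorem comm_eS (n s r : ℕ) (j k l : Fin n) : ∀ i,
    eS n r i j * eS n s k l - eS n s k l * eS n r i j = ∑ a ∈ Finset.range r,
      (quadE n (a + s) (s + (r - 1 - a)) a i j k l - quadE n a (r - 1 - a) (s + a) i j k l) ∧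
    fS n r i j * eS n s k l - eS n s k l * fS n r i j = ∑ a ∈ Finset.range r,
      (quadF n (a + s) (s + (r - 1 - a)) a i j k l - quadF n a (r - 1 - a) (s + a) i j k l) := by
  obtain ⟨g1, -, g3, -⟩ := generator_sergeev n s
  induction r with
  | zero => intro i; by_cases hij : i = j <;> simp [eS_zero, fS_zero, hij]
  | succ r ih =>
    intro i
    rw [eS_succ_eq_step, fS_succ_eq_step, step_comm, step_comm]
    simp only [fun i => (ih i).1, fun i => (ih i).2, step_sum, step_sub, g1, g3,
      sum_delta_sub_mul]
    -- The operator applied to the inductive brackets yields the summands a < r. The generator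
    -- brackets yield the summand a = r, whose subtracted term has index 0 and so is a Kronecker
    -- delta, matched through `eS_add` and `fS_add`.
    rw [Finset.sum_range_succ, Finset.sum_range_succ, Nat.add_sub_cancel, Nat.sub_self, add_zero,
      quadE_zero, quadF_zero]
    refine ⟨congrArg₂ (· + ·) (Finset.sum_congr rfl fun a ha => ?_) ?_,
      congrArg₂ (· + ·) (Finset.sum_congr rfl fun a ha => ?_) ?_⟩
    · obtain ⟨q, rfl⟩ := Nat.exists_eq_add_of_lt (Finset.mem_range.1 ha)
      rw [show a + q + 1 - 1 - a = q by omega, show a + q + 1 - a = q + 1 by omega,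
        step_quadE _ _ _ _ _ _ _ _ _ ⟨a + s + q, by ring⟩,
        step_quadE _ _ _ _ _ _ _ _ _ ⟨a + q, by ring⟩, add_assoc]
    · simp only [quadE, eS_add, ← neg_one_pow_zsmul, pow_add, smul_mul_assoc, smul_smul]
      split_ifs <;> module
    · obtain ⟨q, rfl⟩ := Nat.exists_eq_add_of_lt (Finset.mem_range.1 ha)
      rw [show a + q + 1 - 1 - a = q by omega, show a + q + 1 - a = q + 1 by omega,
        step_quadF _ _ _ _ _ _ _ _ _ ⟨a + s + q, by ring⟩,
        step_quadF _ _ _ _ _ _ _ _ _ ⟨a + q, by ring⟩, add_assoc]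
    · simp only [quadF, fS_add, ← neg_one_pow_zsmul, pow_add, smul_mul_assoc, smul_smul]
      split_ifs <;> module

/-- Supercommutators of Sergeev's elements with the odd ones. -/
theorem comm_fS (n s r : ℕ) (j k l : Fin n) : ∀ i,
    eS n r i j * fS n s k l - fS n s k l * eS n r i j = ∑ a ∈ Finset.range r,
      ((-1 : ℤ) ^ (a + s) • quadF n (a + s + 1) (s + (r - 1 - a)) a i j k l
        - (-1 : ℤ) ^ a • quadF n (a + 1) (r - 1 - a) (s + a) i j k l) ∧
    fS n r i j * fS n s k l + fS n s k l * fS n r i j = ∑ a ∈ Finset.range r,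
      ((-1 : ℤ) ^ (a + s) • -quadE n (a + s + 1) (s + (r - 1 - a)) a i j k l
        - (-1 : ℤ) ^ a • -quadE n (a + 1) (r - 1 - a) (s + a) i j k l) := by
  obtain ⟨-, g2, -, g4⟩ := generator_sergeev n s
  induction r with
  | zero => intro i; by_cases hij : i = j <;> simp [eS_zero, fS_zero, hij]
  | succ r ih =>
    intro i
    rw [eS_succ_eq_step, fS_succ_eq_step, step_comm_of_odd, step_anticomm]
    simp only [fun i => (ih i).1, fun i => (ih i).2, step_sum, step_sub, g2, g4,
      sum_delta_sub_mul, sum_delta_add_mul]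
    rw [Finset.sum_range_succ, Finset.sum_range_succ, Nat.add_sub_cancel, Nat.sub_self, add_zero,
      quadE_zero, quadF_zero]
    refine ⟨congrArg₂ (· + ·) (Finset.sum_congr rfl fun a ha => ?_) ?_,
      congrArg₂ (· + ·) (Finset.sum_congr rfl fun a ha => ?_) ?_⟩
    · obtain ⟨q, rfl⟩ := Nat.exists_eq_add_of_lt (Finset.mem_range.1 ha)
      rw [show a + q + 1 - 1 - a = q by omega, show a + q + 1 - a = q + 1 by omega,
        step_smul_quadF_neg _ _ _ _ _ _ _ _ _ _ ⟨a + s + q + 1, by ring⟩,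
        step_smul_quadF_neg _ _ _ _ _ _ _ _ _ _ ⟨a + q + 1, by ring⟩, add_assoc s q 1]
    · simp only [quadF, fS_add, ← neg_one_pow_zsmul, pow_add, smul_mul_assoc]
      rcases neg_one_pow_eq_or ℤ r with hr | hr <;>
        rcases neg_one_pow_eq_or ℤ s with hs | hs <;>
        simp only [hr, hs] <;> split_ifs <;> module
    · obtain ⟨q, rfl⟩ := Nat.exists_eq_add_of_lt (Finset.mem_range.1 ha)
      rw [show a + q + 1 - 1 - a = q by omega, show a + q + 1 - a = q + 1 by omega,
        step_smul_quadE_neg _ _ _ _ _ _ _ _ _ _ ⟨a + s + q + 1, by ring⟩,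
        step_smul_quadE_neg _ _ _ _ _ _ _ _ _ _ ⟨a + q + 1, by ring⟩, add_assoc s q 1]
    · simp only [quadE, eS_add, ← neg_one_pow_zsmul, pow_add, smul_mul_assoc]
      rcases neg_one_pow_eq_or ℤ r with hr | hr <;>
        rcases neg_one_pow_eq_or ℤ s with hs | hs <;>
        simp only [hr, hs] <;> split_ifs <;> module

/-! ### Commutativity from quadratic relations. -/

theorem neg_one_pow_eq_of_even_add {p q : ℕ} (h : Even (p + q)) : (-1 : ℤ) ^ p = (-1) ^ q := by
  rcases Nat.even_or_odd q with hq | hq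
  · rw [hq.neg_one_pow, ((Nat.even_add.1 h).2 hq).neg_one_pow]
  · have hp : Odd p := by
      rw [← Nat.not_even_iff_odd] at hq ⊢
      exact fun hp => hq ((Nat.even_add.1 h).1 hp)
    rw [hq.neg_one_pow, hp.neg_one_pow]

/-- If two sequences satisfy quadratic relations of Sergeev's type, then terms of the first whose
indices have the same parity commute. -/
theorem commute_of_quadratic {R : Type*} [Ring R] (x y : ℕ → R)
    (hx : ∀ r s, x r * x s - x s * x r = ∑ a ∈ Finset.range r,
      ((x (s + (r - 1 - a)) * x a - (-1 : ℤ) ^ (a + s) • (y (s + (r - 1 - a)) * y a))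
        - (x (r - 1 - a) * x (s + a) - (-1 : ℤ) ^ a • (y (r - 1 - a) * y (s + a)))))
    (hy : ∀ r s, y r * y s + y s * y r = ∑ a ∈ Finset.range r,
      ((-1 : ℤ) ^ (a + s) • -(x (s + (r - 1 - a)) * x a
          - (-1 : ℤ) ^ (a + s + 1) • (y (s + (r - 1 - a)) * y a))
        - (-1 : ℤ) ^ a • -(x (r - 1 - a) * x (s + a)
          - (-1 : ℤ) ^ (a + 1) • (y (r - 1 - a) * y (s + a)))))
    (r s : ℕ) (hrs : Even (r + s)) : x r * x s - x s * x r = 0 := by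
  -- Reversing the second half of the sum makes each summand involve a single index pair, a and s +
  -- r - 1 - a.
  have hx' : ∀ r s, x r * x s - x s * x r = ∑ a ∈ Finset.range r,
      (x (s + (r - 1 - a)) * x a - x a * x (s + (r - 1 - a))
        - (-1 : ℤ) ^ (a + s) • (y (s + (r - 1 - a)) * y a)
        - (-1 : ℤ) ^ (r + a) • (y a * y (s + (r - 1 - a)))) := by
    intro r s
    rw [hx, Finset.sum_sub_distrib, ← Finset.sum_range_reflect (fun a => x (r - 1 - a) * _ - _),
      ← Finset.sum_sub_distrib]
    refine Finset.sum_congr rfl fun a ha => ?_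
    obtain ⟨q, rfl⟩ := Nat.exists_eq_add_of_lt (Finset.mem_range.1 ha)
    rw [show a + q + 1 - 1 - a = q by omega, show a + q + 1 - 1 - q = a by omega,
      show a + q + 1 + a = q + 1 + (a + a) by ring, pow_add _ (q + 1), (Even.add_self a).neg_one_pow]
    module
  have hy' : ∀ r s, y r * y s + y s * y r = ∑ a ∈ Finset.range r,
      (y a * y (s + (r - 1 - a)) - y (s + (r - 1 - a)) * y a
        - (-1 : ℤ) ^ (a + s) • (x (s + (r - 1 - a)) * x a)
        - (-1 : ℤ) ^ (r + a) • (x a * x (s + (r - 1 - a)))) := by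
    intro r s
    rw [hy, Finset.sum_sub_distrib,
      ← Finset.sum_range_reflect (fun a => (-1 : ℤ) ^ a • -(x (r - 1 - a) * _ - _)),
      ← Finset.sum_sub_distrib]
    refine Finset.sum_congr rfl fun a ha => ?_
    obtain ⟨q, rfl⟩ := Nat.exists_eq_add_of_lt (Finset.mem_range.1 ha)
    rw [show a + q + 1 - 1 - a = q by omega, show a + q + 1 - 1 - q = a by omega,
      show a + q + 1 + a = q + 1 + (a + a) by ring, pow_add _ (q + 1), (Even.add_self a).neg_one_pow]
    rcases neg_one_pow_eq_or ℤ q with hq | hq <;>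
      rcases neg_one_pow_eq_or ℤ (a + s) with has | has <;>
      simp only [pow_succ _ q, pow_succ _ (a + s), hq, has] <;> module
  clear hx hy
  obtain ⟨N, hN⟩ : ∃ N, r + s = N := ⟨_, rfl⟩
  induction N using Nat.strong_induction_on generalizing r s with
  | _ N ihN =>
  induction r using Nat.twoStepInduction generalizing s with
  | zero => simp [hx' 0 s]
  | one =>
    have hs : Odd s := by
      obtain ⟨c, hc⟩ := hrs
      exact ⟨c - 1, by omega⟩
    have h1 := hx' 1 s
    have h2 := hx' 0 s
    have h3 := hy' 0 s
    simp only [Finset.sum_range_one, Finset.sum_range_zero, zero_add, add_zero, Nat.sub_self,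
      hs.neg_one_pow, pow_one] at h1 h2 h3
    rw [h1]
    -- Since s is odd, the two y-terms have equal sign and form an anticommutator; the relations
    -- with r = 0 have empty right-hand sides.
    have h4 : x s * x 0 - x 0 * x s - (-1 : ℤ) • (y s * y 0) - (-1 : ℤ) • (y 0 * y s)
        = (y 0 * y s + y s * y 0) - (x 0 * x s - x s * x 0) := by module
    rw [h4, h3, h2, sub_zero]
  | more r ihr _ =>
    have h0 := ihr (s + 2) (by rwa [add_right_comm, add_assoc] at hrs) (by omega)
    have hr : Even (r + s) := by
      obtain ⟨c, hc⟩ := hrs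
      exact ⟨c - 1, by omega⟩
    -- Both expansions have the same index pairs, of total r + s + 1, with equal signs. Only the
    -- summands a = r and a = r + 1 of the longer one survive.
    have e1 : (x (r + 2) * x s - x s * x (r + 2)) - (x r * x (s + 2) - x (s + 2) * x r)
        = -((x (r + 1) * x s - x s * x (r + 1)) - (y (r + 1) * y s + y s * y (r + 1))
          + (x r * x (s + 1) - x (s + 1) * x r) + (y r * y (s + 1) + y (s + 1) * y r)) := by
      rw [hx' (r + 2) s, hx' r (s + 2), Finset.sum_range_succ, Finset.sum_range_succ]
      have hlow : ∀ a ∈ Finset.range r, s + (r + 2 - 1 - a) = s + 2 + (r - 1 - a) := by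
        intro a ha
        have := Finset.mem_range.1 ha
        omega
      rw [Finset.sum_congr rfl fun a ha => by
        rw [hlow a ha, neg_one_pow_eq_of_even_add (⟨r + a + 1, by omega⟩ : Even (r + 2 + a + (r + a))),
          neg_one_pow_eq_of_even_add (⟨a + s + 1, by omega⟩ : Even (a + s + (a + (s + 2))))]]
      rw [show r + 2 - 1 - r = 1 by omega, show r + 2 - 1 - (r + 1) = 0 by omega, add_zero,
        show r + 2 + (r + 1) = (r + 1) + (r + 1) + 1 by ring, pow_succ _ (r + 1 + (r + 1)),
        (Even.add_self (r + 1)).neg_one_pow,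
        Even.neg_one_pow (⟨r + 1, by omega⟩ : Even (r + 2 + r)),
        show r + 1 + s = r + s + 1 by ring, pow_succ, hr.neg_one_pow]
      module
    -- Expanding once more gives index pairs of total r + s, which is even and below N, so the x's
    -- in each pair commute by induction. The rest cancels: for a < r between the four sums, and for
    -- a = r between the two longer ones.
    have e2 : ((x (r + 1) * x s - x s * x (r + 1)) - (y (r + 1) * y s + y s * y (r + 1))
          + (x r * x (s + 1) - x (s + 1) * x r) + (y r * y (s + 1) + y (s + 1) * y r)) = 0 := by
      have hsplit : ∀ A B C D u v : R,
          A + u - (B + v) + C + D = A - B + C + D + (u - v) := by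
        intros
        abel
      rw [hx' (r + 1) s, hy' (r + 1) s, hx' r (s + 1), hy' r (s + 1), Finset.sum_range_succ,
        Finset.sum_range_succ, hsplit, ← Finset.sum_sub_distrib, ← Finset.sum_add_distrib,
        ← Finset.sum_add_distrib, Finset.sum_eq_zero, zero_add]
      · have hc := ihN (s + r) (by omega) s r (by rwa [add_comm]) rfl
        rw [Nat.add_sub_cancel, Nat.sub_self, add_zero, hr.neg_one_pow,
          show r + 1 + r = r + r + 1 by ring, pow_succ, (Even.add_self r).neg_one_pow,
          ← sub_eq_zero.1 hc]
        module
      · intro a ha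
        obtain ⟨q, rfl⟩ := Nat.exists_eq_add_of_lt (Finset.mem_range.1 ha)
        obtain ⟨c, hc⟩ := hr
        have hcomm := ihN (s + (q + 1) + a) (by omega) (s + (q + 1)) a ⟨c, by omega⟩ rfl
        rw [show a + q + 1 + 1 - 1 - a = q + 1 by omega, show a + q + 1 - 1 - a = q by omega,
          show s + 1 + q = s + (q + 1) by ring, ← sub_eq_zero.1 hcomm,
          neg_one_pow_eq_of_even_add (⟨c + a, by omega⟩ : Even (a + q + 1 + a + (a + s))),
          show a + q + 1 + 1 + a = a + q + 1 + a + 1 by ring, pow_succ _ (a + q + 1 + a),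
          neg_one_pow_eq_of_even_add (⟨c + a, by omega⟩ : Even (a + q + 1 + a + (a + s))),
          ← add_assoc a s 1, pow_succ]
        module
    rw [e2, h0, neg_zero, sub_zero] at e1
    exact e1

/-- The elements `e^{(r)}_{ij}` and `e^{(s)}_{ij}` commute if `r` and `s` have the same parity. -/
theorem eS_comm (n r s : ℕ) (i j : Fin n) (hrs : Even (r + s)) :
    eS n r i j * eS n s i j - eS n s i j * eS n r i j = 0 :=
  commute_of_quadratic (fun m => eS n m i j) (fun m => fS n m i j)
    (fun r s => (comm_eS n s r j i j i).1) (fun r s => (comm_fS n s r j i j i).2) r s hrs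

/-! ### The Dynkin grading and Whittaker vectors. -/

/-- Bracketing with h multiplies the (i,j) entry of each block by h_i - h_j = 2(j - i). -/
theorem coeff_eq_zero_of_mem_dynkinPart (n : ℕ) (d : ℤ) (X : queer n) (hX : X ∈ dynkinPart n d)
    (A B : Matrix (Fin n) (Fin n) ℂ) (hAB : X.1 = Matrix.fromBlocks A B B A) (i j : Fin n)
    (hij : 2 * ((j : ℤ) - i) ≠ d) : A i j = 0 ∧ B i j = 0 := by
  have hh : (h n).1 = Matrix.fromBlocks (Matrix.diagonal fun i : Fin n => (n : ℂ) - 1 - 2 * (i : ℂ))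
      0 0 (Matrix.diagonal fun i : Fin n => (n : ℂ) - 1 - 2 * (i : ℂ)) := by
    ext a b
    rcases a with a | a <;> rcases b with b | b <;>
      simp [h, e, Matrix.sum_apply, Matrix.single_apply, Matrix.diagonal_apply]
    all_goals simp [ite_and]
  have key : (h n).1 * X.1 - X.1 * (h n).1 - (d : ℂ) • X.1 = 0 := congrArg Subtype.val hX
  rw [hh, hAB, Matrix.fromBlocks_multiply, Matrix.fromBlocks_multiply, Matrix.fromBlocks_smul] at key
  have hne : (2 * ((j : ℂ) - i) - d) ≠ 0 := by
    rw [sub_ne_zero]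
    exact_mod_cast hij
  have k1 := congrFun₂ key (Sum.inl i) (Sum.inl j)
  have k2 := congrFun₂ key (Sum.inl i) (Sum.inr j)
  simp [Matrix.diagonal_mul, Matrix.mul_diagonal] at k1 k2
  exact ⟨(mul_eq_zero.1 (by linear_combination k1)).resolve_left hne,
    (mul_eq_zero.1 (by linear_combination k2)).resolve_left hne⟩

theorem eq_sum_e_f (n : ℕ) (X : queer n) (A B : Matrix (Fin n) (Fin n) ℂ)
    (hAB : X.1 = Matrix.fromBlocks A B B A) :
    X = ∑ i, ∑ j, (A i j • e n i j + B i j • f n i j) := by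
  apply Subtype.ext
  rw [hAB]
  ext a b
  rcases a with a | a <;> rcases b with b | b <;>
      simp [e, f, Matrix.sum_apply, Matrix.single_apply]
  all_goals simp [ite_and]

/-- The corner elements `e^{(m)}_{n,1}` commute with `𝔪`. -/
theorem ι_mul_eS_corner (n m : ℕ) (i₀ j₀ : Fin n) (hi : ∀ i, i ≤ i₀) (hj : ∀ j, j₀ ≤ j)
    (a : queer n) (ha : a ∈ 𝔪 n) : ι n a * eS n m i₀ j₀ = eS n m i₀ j₀ * ι n a := by
  obtain ⟨g1, -, g3, -⟩ := generator_sergeev n m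
  suffices hle : 𝔪 n ≤ LinearMap.ker ((LinearMap.mulRight ℂ (eS n m i₀ j₀)
      - LinearMap.mulLeft ℂ (eS n m i₀ j₀)) ∘ₗ ι n) from sub_eq_zero.1 (hle ha)
  refine iSup_le fun d X hX => ?_
  obtain ⟨A, B, hAB⟩ := X.2
  rw [eq_sum_e_f n X A B hAB]
  refine Submodule.sum_mem _ fun i _ => Submodule.sum_mem _ fun j _ => ?_
  by_cases hij : j < i
  · refine Submodule.add_mem _ (Submodule.smul_mem _ _ ?_) (Submodule.smul_mem _ _ ?_)
    · refine (g1 i j i₀ j₀).trans ?_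
      rw [if_neg (hij.trans_le (hi i)).ne, if_neg ((hj j).trans_lt hij).ne', sub_zero]
    · refine (g3 i j i₀ j₀).trans ?_
      rw [if_neg (hij.trans_le (hi i)).ne, if_neg ((hj j).trans_lt hij).ne', sub_zero]
  -- On or above the diagonal the weight 2(j - i) is nonnegative, so it differs from the negative
  -- degree.
  · obtain ⟨h1, h2⟩ := coeff_eq_zero_of_mem_dynkinPart n _ X hX A B hAB i j (by
      rw [Fin.lt_def] at hij
      omega)
    rw [h1, h2, zero_smul, zero_smul, add_zero]
    exact Submodule.zero_mem _

/-- If u commutes with 𝔪, then a acts on π(u) = u·π(1) through its action on π(1), which is by χ(a).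
-/
theorem π_mem_whittaker (n : ℕ) (u : U n) (hu : ∀ a ∈ 𝔪 n, ι n a * u = u * ι n a) :
    π n u ∈ whittaker n := by
  intro a ha
  rw [← map_smul, smul_eq_mul, hu a ha, ← smul_eq_mul, map_smul, ← smul_π_one n (ι n a),
    π_one_mem n a ha, smul_comm, smul_π_one]

end QueerW

/-! ### Transfer to the finite W-algebra. -/

theorem mainTheorem12 (n : ℕ) (hn : 1 ≤ n) (k m : ℤ) (hk : Odd k) (hm : Odd m)
    (hnk : 1 ≤ (n : ℤ) + k) (hnm : 1 ≤ (n : ℤ) + m) :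
    ∃ (hek : QueerW.π n (QueerW.eS n ((n : ℤ) + k).toNat ⟨n - 1, by omega⟩ ⟨0, by omega⟩)
          ∈ QueerW.whittaker n)
      (hem : QueerW.π n (QueerW.eS n ((n : ℤ) + m).toNat ⟨n - 1, by omega⟩ ⟨0, by omega⟩)
          ∈ QueerW.whittaker n),
      ⁅(QueerW.identify n).symm ⟨_, hek⟩, (QueerW.identify n).symm ⟨_, hem⟩⁆ = 0 := by
  have hmem : ∀ r, QueerW.π n (QueerW.eS n r ⟨n - 1, by omega⟩ ⟨0, by omega⟩)
      ∈ QueerW.whittaker n := fun r =>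
    QueerW.π_mem_whittaker n _ (QueerW.ι_mul_eS_corner n r _ _
      (fun i => Fin.le_def.2 (Nat.le_sub_one_of_lt i.2)) fun j => Fin.le_def.2 (Nat.zero_le _))
  refine ⟨hmem _, hmem _, ?_⟩
  apply (QueerW.identify n).injective
  apply Subtype.ext
  rw [Ring.lie_def, map_sub, map_zero, Submodule.coe_sub,
    QueerW.identify_mul n _ _ _ _ (by rw [LinearEquiv.apply_symm_apply])
      (by rw [LinearEquiv.apply_symm_apply]),
    QueerW.identify_mul n _ _ _ _ (by rw [LinearEquiv.apply_symm_apply])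
      (by rw [LinearEquiv.apply_symm_apply]),
    -- The difference is π of a commutator that already vanishes in U(Q(n)).
    ← map_sub, QueerW.eS_comm, map_zero]
  · rfl
  · obtain ⟨a, ha⟩ := hk
    obtain ⟨b, hb⟩ := hm
    -- The lower bounds make `toNat` exact, so the index sum is 2n + k + m.
    rw [Nat.even_iff]
    omega
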